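/- **Setting.** Let $E\in\mathbb R^{n\times n}$ be the prefix-sum matrix ($E_{ij}=1$ for $j\le i$, and $0$ otherwise). For $0<\gamma<1$ and bandwidth $p$, the $\gamma$-BIFR strategy matrix $C_\gamma^{(p)}\in\mathbb R^{n\times n}$ is defined through its inverse: $(C_\gamma^{(p)})^{-1}$ is the lower triangular Toeplitz matrix with value $(\tilde c_\gamma)_i=(-1)^i\binom{\gamma}{i}$, where $\binom{\gamma}{i}=\prod_{j=1}^{i}\frac{\gamma+1-j}{j}$, on the $i$-th subdiagonal for $0\le i\le p-1$, and $0$ elsewhere. Put $B_\gamma^{(p)}=E\,(C_\gamma^{(p)})^{-1}$. Two streams $G,G'\in\mathbb R^{n\times d}$ are neighbouring, $G\sim G'$, if there is a set $S$ of at most $k$ row indices, any two of which differ by at least $b$, such that the rows of $G$ and $G'$ agree outside $S$ and differ by at most $1$ in Euclidean norm on $S$. Let $\mathrm{sens}(C)=\sup_{G\sim G'}\|CG-CG'\|_F$, and let the RMSE be $\mathcal E(B,C)=\|B\|_F\cdot\mathrm{sens}(C)/\sqrt n$. Here $\log$ is the natural logarithm. **Theorem.** There is an absolute constant $K>0$ such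 that for all integers $n,p,k,b,d$ with $2\le p\le n$, $b\ge1$, $1\le k\le n/b$ and $d\ge1$ the following holds. 1. For every real $\gamma$ with $|\gamma-\tfrac12|\le\frac1{4\log p}$ one has $0<\gamma<1$ and $$\mathcal E(B_\gamma^{(p)},C_\gamma^{(p)})\le K\left(\sqrt k\log p+\sqrt{\frac{nk}{b}}+\sqrt{\frac{nk\log p}{p}}+\sqrt{\frac{kp\log p}{b}}\right).$$ 2. If in addition $p\le\sqrt n/4$, then $\gamma=1-p/\sqrt n$ satisfies $0<\gamma<1$ and $$\mathcal E(B_\gamma^{(p)},C_\gamma^{(p)})\le K\left(\sqrt k\,n^{1/4}+\sqrt{\frac{nk}{b}}\right),$$ and this bound is tighter than the first one: $$\sqrt k\,n^{1/4}+\sqrt{\frac{nk}{b}}<\sqrt k\log p+\sqrt{\frac{nk}{b}}+\sqrt{\frac{nk\log p}{p}}+\sqrt{\frac{kp\log p}{b}}.$$ -/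

import Mathlib

noncomputable section

namespace BIFR

open scoped Matrix.Norms.Frobenius

/-- The prefix-sum matrix `E`: ones on and below the diagonal, zeros above. -/
def prefixSum (n : ℕ) : Matrix (Fin n) (Fin n) ℝ :=
  Matrix.of fun i j => if j ≤ i then 1 else 0

/-- The generalized binomial coefficient `binom(γ, i) = ∏_{j=1}^{i} (γ + 1 - j) / j`. -/
def genBinom (γ : ℝ) (i : ℕ) : ℝ :=
  ∏ j ∈ Finset.Icc 1 i, (γ + 1 - (j : ℝ)) / (j : ℝ)

/-- The coefficients `(-1)^i binom(γ, i)` of the power series of `(1 - x)^γ`. -/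
def invCoeff (γ : ℝ) (i : ℕ) : ℝ :=
  (-1) ^ i * genBinom γ i

/-- The correlation matrix of `γ`-BIFR with bandwidth `p`: the lower triangular Toeplitz matrix
whose diagonals `0, …, p - 1` (diagonal `0` being the main one) carry the values
`invCoeff γ 0 = 1, …, invCoeff γ (p - 1)`, all other entries being `0`. -/
def correlation (n p : ℕ) (γ : ℝ) : Matrix (Fin n) (Fin n) ℝ :=
  Matrix.of fun i j =>
    if j ≤ i ∧ (i : ℕ) - (j : ℕ) < p then invCoeff γ ((i : ℕ) - (j : ℕ)) else 0

/-- The strategy matrix `C` of `γ`-BIFR with bandwidth `p`, given through its inverse. -/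
def strategy (n p : ℕ) (γ : ℝ) : Matrix (Fin n) (Fin n) ℝ :=
  (correlation n p γ)⁻¹

/-- The left factor `B = E C⁻¹` of the factorization `E = B C`. -/
def leftFactor (n p : ℕ) (γ : ℝ) : Matrix (Fin n) (Fin n) ℝ :=
  prefixSum n * (strategy n p γ)⁻¹

/-- A participation pattern: a set of at most `k` iterations, any two of which are at least `b`
steps apart (`b`-min-separation). -/
def IsParticipation {n : ℕ} (k b : ℕ) (S : Finset (Fin n)) : Prop :=
  S.card ≤ k ∧ ∀ i ∈ S, ∀ j ∈ S, i < j → (i : ℕ) + b ≤ (j : ℕ)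

/-- Two streams of `d`-dimensional gradients (row `i` is the gradient of iteration `i`) are
neighbouring if they differ in the participation of a single data point: they agree outside some
participation pattern, and inside it their rows differ by at most `1` (the clipping norm,
normalized) in Euclidean norm. -/
def Neighbouring {n d : ℕ} (k b : ℕ) (G G' : Matrix (Fin n) (Fin d) ℝ) : Prop :=
  ∃ S : Finset (Fin n), IsParticipation k b S ∧
    (∀ i ∉ S, G i = G' i) ∧
    (∀ i ∈ S, ‖WithLp.toLp 2 (G i) - WithLp.toLp 2 (G' i)‖ ≤ 1)

/-- The values whose supremum is the sensitivity of `C`; `‖·‖` is the Frobenius norm. -/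
def sensSet {n : ℕ} (k b d : ℕ) (C : Matrix (Fin n) (Fin n) ℝ) : Set ℝ :=
  {x | ∃ G G' : Matrix (Fin n) (Fin d) ℝ, Neighbouring k b G G' ∧ x = ‖C * G - C * G'‖}

/-- The sensitivity `sup_{G ∼ G'} ‖C G - C G'‖_F` for `d`-dimensional streams under
`b`-min-separation with at most `k` participations. The supremum is over a nonempty bounded set,
see `sensSet_nonempty` and `sensSet_bddAbove`. -/
def sens {n : ℕ} (k b d : ℕ) (C : Matrix (Fin n) (Fin n) ℝ) : ℝ :=
  sSup (sensSet k b d C)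

/-- The RMSE objective `‖B‖_F · sens(C) / √n` of a factorization `E = B C`. -/
def rmse {n : ℕ} (k b d : ℕ) (B C : Matrix (Fin n) (Fin n) ℝ) : ℝ :=
  ‖B‖ * sens k b d C / Real.sqrt n

theorem sensSet_nonempty {n : ℕ} (k b d : ℕ) (C : Matrix (Fin n) (Fin n) ℝ) :
    (sensSet k b d C).Nonempty :=
  ⟨_, 0, 0, ⟨∅, ⟨by simp, by simp⟩, by simp, by simp⟩, rfl⟩

theorem sensSet_bddAbove {n : ℕ} (k b d : ℕ) (C : Matrix (Fin n) (Fin n) ℝ) :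
    BddAbove (sensSet k b d C) := by
  refine ⟨‖C‖ * Real.sqrt n, ?_⟩
  rintro x ⟨G, G', ⟨S, -, h0, h1⟩, rfl⟩
  rw [← Matrix.mul_sub]
  refine (Matrix.frobenius_norm_mul C (G - G')).trans ?_
  refine mul_le_mul_of_nonneg_left ?_ (norm_nonneg _)
  have hrow : ∀ i, ‖WithLp.toLp 2 ((G - G') i)‖ ^ 2 ≤ 1 := by
    intro i
    have hle : ‖WithLp.toLp 2 ((G - G') i)‖ ≤ 1 := by
      by_cases hi : i ∈ S
      · exact h1 i hi
      · have : (G - G') i = 0 := by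
          have := h0 i hi
          ext j
          simp [Matrix.sub_apply, this]
        rw [this]
        simp
    exact pow_le_one₀ (norm_nonneg _) hle
  have hnorm : ‖G - G'‖ = Real.sqrt (∑ i, ‖WithLp.toLp 2 ((G - G') i)‖ ^ 2) := by
    rw [Matrix.frobenius_norm_def, Real.sqrt_eq_rpow]
    congr 1
    refine Finset.sum_congr rfl fun i _ => ?_
    rw [EuclideanSpace.norm_sq_eq]
    refine Finset.sum_congr rfl fun j _ => ?_
    exact Real.rpow_two _
  rw [hnorm]
  refine Real.sqrt_le_sqrt ((Finset.sum_le_sum fun i _ => hrow i).trans ?_)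
  simp

theorem det_correlation (n p : ℕ) (hp : 1 ≤ p) (γ : ℝ) : (correlation n p γ).det = 1 := by
  rw [Matrix.det_of_isLowerTriangular]
  · refine Finset.prod_eq_one fun i _ => ?_
    have : 0 < p := hp
    simp [correlation, invCoeff, genBinom, this]
  · intro i j hij
    have : ¬ j ≤ i := not_le.mpr (by simpa using hij)
    simp [correlation, this]

/-- The strategy matrix is indeed determined by its inverse. -/
theorem strategy_inv (n p : ℕ) (hp : 1 ≤ p) (γ : ℝ) :
    (strategy n p γ)⁻¹ = correlation n p γ :=
  Matrix.nonsing_inv_nonsing_inv _ (by simp [det_correlation n p hp γ])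

/-- `B C = E`. -/
theorem leftFactor_mul_strategy (n p : ℕ) (hp : 1 ≤ p) (γ : ℝ) :
    leftFactor n p γ * strategy n p γ = prefixSum n := by
  have h : IsUnit (correlation n p γ).det := by simp [det_correlation n p hp γ]
  rw [leftFactor, strategy_inv n p hp, strategy, Matrix.mul_assoc, Matrix.mul_nonsing_inv _ h,
    Matrix.mul_one]

end BIFR

end

/-! Lower triangular Toeplitz matrices multiply like power series. `C⁻¹` corresponds to `(1 - X)^γ`
truncated below degree `p`. Hence `B` has coefficients `g m = fracCoeff γ m`, frozen at `g (p - 1)`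
from there on, and the coefficients `c m` of `C` agree with those of `(1 - X)^(-γ)` for `m < p`. The
truncated recurrence makes `c` nonnegative and nonincreasing. As `c` convolved with the coefficients
of `B` gives the series `1 / (1 - X)`, the sum of `c` is at most `M = 1 / g (p - 1)`.

Nonnegativity reduces the sensitivity to sums of columns of `C` over a participation pattern. In the
square of such a sum, monotonicity and `b`-separation bound the entries left of a given column by `M
/ b` in total (`mul_sum_sub_le`). This gives `rmse_le`: the squared error is at most `(∑ g² + n
g(p-1)²) * k (∑ c² + c(p-1) M + 2 M² / b)`, with sums over `m < p`.

It remains to insert `(1 - γ) m^(-γ) ≤ g m ≤ 2 (1 - γ) (m + 1)^(-γ)` for `m ≥ 1`, and similar bounds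
for `c`. For `γ` within `1 / (4 log p)` of `1/2`, the deviation costs only a constant, and the
factors are of order `log p + n / p` and `k (log p + p / b)`. For `γ = 1 - δ` with `δ = p / √n`, the
small factor `1 - γ = δ` makes them of order `P²` and `k (√n + n / b) / P²`, where `P = p^δ`
cancels. -/

noncomputable section

namespace BIFR

open Finset

/-! ### Size and identities of the coefficients of fractional powers of `1 - X`. -/

/-- The coefficients `∏_{j < m} (1 - x / (j + 1))` of the power series of `(1 - X) ^ (x - 1)`. -/
def fracCoeff (x : ℝ) (m : ℕ) : ℝ :=
  ∏ j ∈ range m, (1 - x / ((j : ℝ) + 1))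

@[simp] theorem fracCoeff_zero (x : ℝ) : fracCoeff x 0 = 1 := by simp [fracCoeff]

theorem fracCoeff_succ (x : ℝ) (m : ℕ) :
    fracCoeff x (m + 1) = fracCoeff x m * (1 - x / ((m : ℝ) + 1)) := by
  simp [fracCoeff, prod_range_succ]

theorem fracCoeff_one (x : ℝ) : fracCoeff x 1 = 1 - x := by simp [fracCoeff]

/-- Coefficientwise form of `((1 - X)^x)' = -x (1 - X)^(x - 1)`. -/
theorem fracCoeff_one_add_succ (x : ℝ) (m : ℕ) :
    fracCoeff (1 + x) (m + 1) = -x / ((m : ℝ) + 1) * fracCoeff x m := by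
  induction m with
  | zero => simp [fracCoeff]
  | succ m ih =>
    rw [fracCoeff_succ, ih, fracCoeff_succ x m]
    have h1 : (m : ℝ) + 1 ≠ 0 := by positivity
    have h2 : (m : ℝ) + 1 + 1 ≠ 0 := by positivity
    push_cast
    field_simp
    ring

theorem invCoeff_eq_fracCoeff (γ : ℝ) (i : ℕ) : invCoeff γ i = fracCoeff (1 + γ) i := by
  induction i with
  | zero => simp [invCoeff, genBinom]
  | succ m ih =>
    rw [fracCoeff_succ, ← ih, invCoeff, invCoeff, genBinom, genBinom,
      prod_Icc_succ_top (by omega), pow_succ]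
    have h1 : (m : ℝ) + 1 ≠ 0 := by positivity
    push_cast
    field_simp
    ring

/-- Taking prefix sums divides `(1 - X)^x` by `1 - X`. -/
theorem sum_range_fracCoeff_one_add (x : ℝ) (m : ℕ) :
    ∑ i ∈ range (m + 1), fracCoeff (1 + x) i = fracCoeff x m := by
  induction m with
  | zero => simp
  | succ m ih =>
    rw [sum_range_succ, ih, fracCoeff_one_add_succ, fracCoeff_succ]
    ring

theorem fracCoeff_pos {x : ℝ} (h1 : x < 1) (m : ℕ) : 0 < fracCoeff x m := by
  refine prod_pos fun j _ => ?_
  have : x / ((j : ℝ) + 1) < 1 := by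
    rw [div_lt_one (by positivity)]
    have : (0 : ℝ) ≤ j := by positivity
    linarith
  linarith

theorem fracCoeff_antitone {x : ℝ} (h0 : 0 ≤ x) (h1 : x < 1) : Antitone (fracCoeff x) := by
  refine antitone_nat_of_succ_le fun m => ?_
  rw [fracCoeff_succ]
  have : 0 ≤ x / ((m : ℝ) + 1) := by positivity
  exact mul_le_of_le_one_right (fracCoeff_pos h1 m).le (by linarith)

theorem fracCoeff_le_one {x : ℝ} (h0 : 0 ≤ x) (h1 : x < 1) (m : ℕ) : fracCoeff x m ≤ 1 :=
  (fracCoeff_antitone h0 h1 (Nat.zero_le m)).trans_eq (fracCoeff_zero x)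

/-- Induction step for the upper bounds, from `log (1 + t) ≤ t` and `1 + y ≤ exp y`. -/
theorem one_sub_div_mul_rpow_neg_le {x : ℝ} (h0 : 0 ≤ x) (m : ℕ) :
    (1 - x / ((m : ℝ) + 1)) * ((m : ℝ) + 1) ^ (-x) ≤ ((m : ℝ) + 1 + 1) ^ (-x) := by
  have hm : (0 : ℝ) < (m : ℝ) + 1 := by positivity
  have ht : (0 : ℝ) < 1 + 1 / ((m : ℝ) + 1) := by positivity
  have e : (m : ℝ) + 1 + 1 = (1 + 1 / ((m : ℝ) + 1)) * ((m : ℝ) + 1) := by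
    field_simp
  rw [e, Real.mul_rpow ht.le hm.le]
  refine mul_le_mul_of_nonneg_right ?_ (by positivity)
  rw [Real.rpow_def_of_pos ht]
  have h2 := Real.add_one_le_exp (Real.log (1 + 1 / ((m : ℝ) + 1)) * -x)
  have h3 := Real.log_le_sub_one_of_pos ht
  have h4 : x * Real.log (1 + 1 / ((m : ℝ) + 1)) ≤ x * (1 / ((m : ℝ) + 1)) :=
    mul_le_mul_of_nonneg_left (by linarith) h0
  rw [mul_one_div] at h4
  linarith

/-- Bernoulli's inequality for exponents in `[0, 1]`; the step for the lower bounds. -/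
theorem rpow_neg_le_one_sub_div_mul {x : ℝ} (h0 : 0 ≤ x) (h1 : x ≤ 1) {m : ℕ} (hm : 1 ≤ m) :
    ((m : ℝ) + 1) ^ (-x) ≤ (1 - x / ((m : ℝ) + 1)) * (m : ℝ) ^ (-x) := by
  have hm0 : (0 : ℝ) < m := by exact_mod_cast hm
  have hm1 : (0 : ℝ) < (m : ℝ) + 1 := by positivity
  have hB := rpow_one_add_le_one_add_mul_self (s := -(1 / ((m : ℝ) + 1)))
    (by rw [neg_le_neg_iff, div_le_one hm1]; linarith) h0 h1
  have e : 1 + -(1 / ((m : ℝ) + 1)) = m / ((m : ℝ) + 1) := by field_simp; ring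
  have e2 : ((m : ℝ) / ((m : ℝ) + 1)) ^ x * (m : ℝ) ^ (-x) = ((m : ℝ) + 1) ^ (-x) := by
    rw [Real.div_rpow hm0.le hm1.le, Real.rpow_neg hm0.le, Real.rpow_neg hm1.le]
    have := (Real.rpow_pos_of_pos hm0 x).ne'
    have := (Real.rpow_pos_of_pos hm1 x).ne'
    field_simp
  rw [← e2, ← e]
  refine mul_le_mul_of_nonneg_right (hB.trans_eq ?_) (by positivity)
  ring

theorem fracCoeff_le_rpow {x : ℝ} (h0 : 0 ≤ x) (h1 : x < 1) (m : ℕ) :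
    fracCoeff x m ≤ ((m : ℝ) + 1) ^ (-x) := by
  induction m with
  | zero => simp
  | succ m ih =>
    rw [fracCoeff_succ, mul_comm]
    push_cast
    refine le_trans (mul_le_mul_of_nonneg_left ih ?_) (one_sub_div_mul_rpow_neg_le h0 m)
    rw [sub_nonneg, div_le_one (by positivity)]
    have : (0 : ℝ) ≤ m := by positivity
    linarith

/-- The factor `1 - x`, already present at `m = 1`, is the gain when `x` is near `1`. The `2`
absorbs `2^(-x) ≥ 1/2` at the start. -/
theorem fracCoeff_le_mul_rpow {x : ℝ} (h0 : 0 ≤ x) (h1 : x < 1) {m : ℕ} (hm : 1 ≤ m) :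
    fracCoeff x m ≤ 2 * (1 - x) * ((m : ℝ) + 1) ^ (-x) := by
  induction m, hm using Nat.le_induction with
  | base =>
    rw [fracCoeff_one]
    have h2 : (2 : ℝ)⁻¹ ≤ (2 : ℝ) ^ (-x) := by
      rw [← Real.rpow_neg_one]
      exact Real.rpow_le_rpow_of_exponent_le (by norm_num) (by linarith)
    have e : ((1 : ℕ) : ℝ) + 1 = 2 := by norm_num
    rw [e]
    nlinarith
  | succ m hm ih =>
    rw [fracCoeff_succ, mul_comm]
    push_cast
    have hx : 0 ≤ 1 - x / ((m : ℝ) + 1) := by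
      rw [sub_nonneg, div_le_one (by positivity)]
      have : (0 : ℝ) ≤ m := by positivity
      linarith
    have h3 := mul_le_mul_of_nonneg_left (one_sub_div_mul_rpow_neg_le h0 m)
      (show 0 ≤ 2 * (1 - x) by linarith)
    have h4 := mul_le_mul_of_nonneg_left ih hx
    linarith

theorem mul_rpow_le_fracCoeff {x : ℝ} (h0 : 0 ≤ x) (h1 : x < 1) {m : ℕ} (hm : 1 ≤ m) :
    (1 - x) * (m : ℝ) ^ (-x) ≤ fracCoeff x m := by
  induction m, hm using Nat.le_induction with
  | base => simp [fracCoeff_one]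
  | succ m hm ih =>
    rw [fracCoeff_succ, mul_comm (fracCoeff x m)]
    push_cast
    have hx : 0 ≤ 1 - x / ((m : ℝ) + 1) := by
      rw [sub_nonneg, div_le_one (by positivity)]
      have : (0 : ℝ) ≤ m := by positivity
      linarith
    have h3 := mul_le_mul_of_nonneg_left (rpow_neg_le_one_sub_div_mul h0 h1.le hm)
      (show 0 ≤ 1 - x by linarith)
    have h4 := mul_le_mul_of_nonneg_left ih hx
    linarith

/-- Discrete integral comparison: Bernoulli with exponent `1 - a` bounds each term by an increment
of the right-hand side. -/
theorem sum_range_rpow_neg_le {a : ℝ} (h0 : 0 ≤ a) (h1 : a < 1) {p : ℕ} (hp : 1 ≤ p) :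
    ∑ i ∈ range p, ((i : ℝ) + 1) ^ (-a) ≤ (p : ℝ) ^ (1 - a) / (1 - a) := by
  have ha : 0 < 1 - a := by linarith
  rw [le_div_iff₀ ha]
  induction p, hp using Nat.le_induction with
  | base => simp; linarith
  | succ m hm ih =>
    rw [sum_range_succ, add_mul]
    have hm0 : (0 : ℝ) < m := by exact_mod_cast hm
    have hm1 : (0 : ℝ) < (m : ℝ) + 1 := by positivity
    have h := rpow_neg_le_one_sub_div_mul (x := 1 - a) ha.le (by linarith) hm
    push_cast
    set A := (m : ℝ) ^ (1 - a) with hA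
    set B := ((m : ℝ) + 1) ^ (1 - a) with hB
    have hA0 : 0 < A := Real.rpow_pos_of_pos hm0 _
    have hB0 : 0 < B := Real.rpow_pos_of_pos hm1 _
    have e : ((m : ℝ) + 1) ^ (-a) = B / ((m : ℝ) + 1) := by
      rw [hB, ← Real.rpow_sub_one hm1.ne']
      congr 1
      ring
    rw [Real.rpow_neg hm1.le, Real.rpow_neg hm0.le, ← hA, ← hB, inv_eq_one_div B,
      ← div_eq_mul_inv, div_le_div_iff₀ hB0 hA0] at h
    have e2 : (1 - (1 - a) / ((m : ℝ) + 1)) * B = B - B / ((m : ℝ) + 1) * (1 - a) := by ring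
    rw [e]
    linarith

/-! ### Lower triangular Toeplitz matrices -/

/-- The lower triangular Toeplitz matrix with the coefficients of `f` on its diagonals. -/
def toeplitz (n : ℕ) (f : PowerSeries ℝ) : Matrix (Fin n) (Fin n) ℝ :=
  Matrix.of fun i j => if j ≤ i then PowerSeries.coeff ((i : ℕ) - (j : ℕ)) f else 0

theorem toeplitz_one (n : ℕ) : toeplitz n 1 = 1 := by
  ext i j
  simp only [toeplitz, Matrix.of_apply, PowerSeries.coeff_one, Matrix.one_apply, Fin.ext_iff,
    Fin.le_def]
  split_ifs <;> first | rfl | omega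

theorem toeplitz_mul (n : ℕ) (f g : PowerSeries ℝ) :
    toeplitz n f * toeplitz n g = toeplitz n (f * g) := by
  ext i k
  simp only [toeplitz, Matrix.mul_apply, Matrix.of_apply, PowerSeries.coeff_mul]
  split_ifs with h
  · rw [Fin.le_def] at h
    have e : ∀ j : Fin n, ((if j ≤ i then PowerSeries.coeff ((i : ℕ) - (j : ℕ)) f else 0) *
        if k ≤ j then PowerSeries.coeff ((j : ℕ) - (k : ℕ)) g else 0) =
        if j ≤ i ∧ k ≤ j then PowerSeries.coeff ((i : ℕ) - (j : ℕ)) f *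
          PowerSeries.coeff ((j : ℕ) - (k : ℕ)) g else 0 := by
      intro j
      split_ifs <;> simp_all
    simp only [e]
    rw [← sum_filter]
    have hk : ∀ x ∈ antidiagonal ((i : ℕ) - (k : ℕ)), (k : ℕ) + x.2 < n := by
      intro x hx
      rw [HasAntidiagonal.mem_antidiagonal] at hx
      have := i.isLt
      omega
    refine sum_bij' (fun j _ => ((i : ℕ) - (j : ℕ), (j : ℕ) - (k : ℕ)))
      (fun x hx => ⟨(k : ℕ) + x.2, hk x hx⟩) ?_ ?_ ?_ ?_ ?_
    · intro j hj
      simp only [mem_filter, mem_univ, true_and, Fin.le_def] at hj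
      rw [HasAntidiagonal.mem_antidiagonal]
      dsimp only
      omega
    · intro x hx
      rw [HasAntidiagonal.mem_antidiagonal] at hx
      simp only [mem_filter, mem_univ, true_and, Fin.le_def]
      omega
    · intro j hj
      simp only [mem_filter, mem_univ, true_and, Fin.le_def] at hj
      ext
      dsimp only
      omega
    · intro x hx
      rw [HasAntidiagonal.mem_antidiagonal] at hx
      ext <;> dsimp only <;> omega
    · intro j hj
      rfl
  · refine sum_eq_zero fun j _ => ?_
    rw [Fin.le_def] at h
    simp only [Fin.le_def]
    split_ifs <;> first | omega | simp

theorem prefixSum_eq_toeplitz (n : ℕ) :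
    prefixSum n = toeplitz n (PowerSeries.mk fun _ => 1) := by
  ext i j
  simp [prefixSum, toeplitz]

/-- The truncation below degree `p` of the power series of `(1 - X) ^ γ`. -/
def truncSeries (p : ℕ) (γ : ℝ) : PowerSeries ℝ :=
  PowerSeries.mk fun i => if i < p then fracCoeff (1 + γ) i else 0

theorem correlation_eq_toeplitz (n p : ℕ) (γ : ℝ) :
    correlation n p γ = toeplitz n (truncSeries p γ) := by
  ext i j
  simp only [correlation, toeplitz, truncSeries, Matrix.of_apply, PowerSeries.coeff_mk,
    invCoeff_eq_fracCoeff, ite_and]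

theorem constantCoeff_truncSeries {p : ℕ} (hp : 1 ≤ p) (γ : ℝ) :
    PowerSeries.constantCoeff (truncSeries p γ) = 1 := by
  rw [← PowerSeries.coeff_zero_eq_constantCoeff_apply]
  have : 0 < p := hp
  simp [truncSeries, this]

theorem truncSeries_mul_inv {p : ℕ} (hp : 1 ≤ p) (γ : ℝ) :
    truncSeries p γ * (truncSeries p γ)⁻¹ = 1 :=
  PowerSeries.mul_inv_cancel _ (by simp [constantCoeff_truncSeries hp])

theorem strategy_eq_toeplitz (n : ℕ) {p : ℕ} (hp : 1 ≤ p) (γ : ℝ) :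
    strategy n p γ = toeplitz n (truncSeries p γ)⁻¹ := by
  rw [strategy]
  refine Matrix.inv_eq_right_inv ?_
  rw [correlation_eq_toeplitz, toeplitz_mul, truncSeries_mul_inv hp, toeplitz_one]

theorem leftFactor_eq_toeplitz (n : ℕ) {p : ℕ} (hp : 1 ≤ p) (γ : ℝ) :
    leftFactor n p γ = toeplitz n ((PowerSeries.mk fun _ => 1) * truncSeries p γ) := by
  rw [leftFactor, strategy_inv n p hp, correlation_eq_toeplitz, prefixSum_eq_toeplitz,
    toeplitz_mul]

/-- Prefix sums of the truncated series stay constant once all `p` terms are included. -/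
theorem coeff_mk_one_mul_truncSeries {p : ℕ} (hp : 1 ≤ p) (γ : ℝ) (m : ℕ) :
    PowerSeries.coeff m ((PowerSeries.mk fun _ => 1) * truncSeries p γ) =
      fracCoeff γ (min m (p - 1)) := by
  rw [mul_comm, PowerSeries.coeff_mul, Nat.sum_antidiagonal_eq_sum_range_succ_mk]
  simp only [truncSeries, PowerSeries.coeff_mk, mul_one]
  rw [← sum_range_fracCoeff_one_add, ← sum_filter]
  congr 1
  ext i
  simp only [mem_filter, mem_range]
  omega

-- The differential equation of `(1 - X)^(x - 1)`, used to identify products without defining real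
-- powers of series.
open PowerSeries in
theorem one_sub_X_mul_derivative_fracCoeff (x : ℝ) :
    (1 - X) * derivative ℝ (PowerSeries.mk (fracCoeff x)) =
      C (1 - x) * PowerSeries.mk (fracCoeff x) := by
  ext m
  rw [sub_mul, one_mul, map_sub, coeff_C_mul, coeff_derivative, coeff_mk, coeff_mk]
  have h1 : (m : ℝ) + 1 ≠ 0 := by positivity
  have e : fracCoeff x (m + 1) * ((m : ℝ) + 1) = fracCoeff x m * ((m : ℝ) + 1 - x) := by
    rw [fracCoeff_succ]
    field_simp
  rw [e]
  cases m with
  | zero => simp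
  | succ m =>
    rw [coeff_succ_X_mul, coeff_derivative, coeff_mk]
    push_cast
    ring

-- The two logarithmic derivatives are opposite, so the product has derivative zero and is its
-- constant term.
open PowerSeries in
theorem mk_fracCoeff_mul_mk_fracCoeff (x : ℝ) :
    PowerSeries.mk (fracCoeff (1 + x)) * PowerSeries.mk (fracCoeff (1 - x)) = 1 := by
  refine derivative.ext ?_ ?_
  · have h : (1 - X : PowerSeries ℝ) ≠ 0 := by
      intro h
      have := congrArg constantCoeff h
      simp at this
    refine mul_left_cancel₀ h ?_
    rw [Derivation.leibniz, smul_eq_mul, smul_eq_mul, Derivation.map_one_eq_zero, mul_zero]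
    have h1 := one_sub_X_mul_derivative_fracCoeff (1 + x)
    have h2 := one_sub_X_mul_derivative_fracCoeff (1 - x)
    have e1 : (1 : ℝ) - (1 + x) = -x := by ring
    have e2 : (1 : ℝ) - (1 - x) = x := by ring
    rw [e1, map_neg] at h1
    rw [e2] at h2
    linear_combination (PowerSeries.mk (fracCoeff (1 + x))) * h2 +
      (PowerSeries.mk (fracCoeff (1 - x))) * h1
  · rw [← coeff_zero_eq_constantCoeff_apply, ← coeff_zero_eq_constantCoeff_apply, coeff_mul]
    simp

/-! ### The coefficients of the strategy matrix. -/

/-- The diagonals of the strategy matrix. -/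
def strategyCoeff (p : ℕ) (γ : ℝ) (m : ℕ) : ℝ :=
  PowerSeries.coeff m (truncSeries p γ)⁻¹

theorem strategyCoeff_zero {p : ℕ} (hp : 1 ≤ p) (γ : ℝ) : strategyCoeff p γ 0 = 1 := by
  simp [strategyCoeff, PowerSeries.coeff_zero_eq_constantCoeff_apply, constantCoeff_truncSeries hp]

theorem strategyCoeff_succ {p : ℕ} (hp : 1 ≤ p) (γ : ℝ) (m : ℕ) :
    strategyCoeff p γ (m + 1) =
      ∑ i ∈ range (m + 1), (if i + 1 < p then -fracCoeff (1 + γ) (i + 1) else 0) *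
        strategyCoeff p γ (m - i) := by
  have h := congrArg (PowerSeries.coeff (m + 1)) (truncSeries_mul_inv hp γ)
  rw [PowerSeries.coeff_mul, Nat.sum_antidiagonal_eq_sum_range_succ_mk, sum_range_succ',
    PowerSeries.coeff_one, if_neg (by omega)] at h
  have h0 : 0 < p := hp
  simp only [truncSeries, PowerSeries.coeff_mk, h0, if_true, fracCoeff_zero, one_mul,
    Nat.add_sub_add_right, Nat.sub_zero] at h
  rw [add_comm] at h
  rw [strategyCoeff, truncSeries, eq_neg_of_add_eq_zero_left h, ← sum_neg_distrib]
  refine sum_congr rfl fun i _ => ?_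
  rw [strategyCoeff, truncSeries]
  split_ifs <;> ring

theorem fracCoeff_one_add_succ_nonpos {γ : ℝ} (h0 : 0 ≤ γ) (h1 : γ < 1) (i : ℕ) :
    fracCoeff (1 + γ) (i + 1) ≤ 0 := by
  rw [fracCoeff_one_add_succ]
  exact mul_nonpos_of_nonpos_of_nonneg (div_nonpos_of_nonpos_of_nonneg (by linarith)
    (by positivity)) (fracCoeff_pos h1 i).le

theorem strategyCoeff_nonneg {p : ℕ} (hp : 1 ≤ p) {γ : ℝ} (h0 : 0 ≤ γ) (h1 : γ < 1) (m : ℕ) :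
    0 ≤ strategyCoeff p γ m := by
  induction m using Nat.strong_induction_on with
  | _ m ih =>
    cases m with
    | zero => simp [strategyCoeff_zero hp]
    | succ m =>
      rw [strategyCoeff_succ hp]
      refine sum_nonneg fun i _ => mul_nonneg ?_ (ih _ (by omega))
      split_ifs
      · linarith [fracCoeff_one_add_succ_nonpos h0 h1 i]
      · exact le_rfl

theorem fracCoeff_one_sub_succ (γ : ℝ) (m : ℕ) :
    fracCoeff (1 - γ) (m + 1) =
      ∑ i ∈ range (m + 1), -fracCoeff (1 + γ) (i + 1) * fracCoeff (1 - γ) (m - i) := by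
  have h := congrArg (PowerSeries.coeff (m + 1)) (mk_fracCoeff_mul_mk_fracCoeff γ)
  rw [PowerSeries.coeff_mul, Nat.sum_antidiagonal_eq_sum_range_succ_mk, sum_range_succ',
    PowerSeries.coeff_one, if_neg (by omega)] at h
  simp only [PowerSeries.coeff_mk, fracCoeff_zero, one_mul,
    Nat.add_sub_add_right, Nat.sub_zero] at h
  simp only [neg_mul, sum_neg_distrib]
  linarith

theorem strategyCoeff_eq_fracCoeff {p : ℕ} (γ : ℝ) {m : ℕ} (hm : m < p) :
    strategyCoeff p γ m = fracCoeff (1 - γ) m := by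
  have hp : 1 ≤ p := by omega
  induction m using Nat.strong_induction_on with
  | _ m ih =>
    cases m with
    | zero => simp [strategyCoeff_zero hp]
    | succ m =>
      rw [strategyCoeff_succ hp, fracCoeff_one_sub_succ]
      refine sum_congr rfl fun i hi => ?_
      rw [mem_range] at hi
      rw [if_pos (by omega), ih _ (by omega) (by omega)]

/-- `p - 1 ≤ m + 1` means that the whole window of nonzero weights fits, so the range no longer
depends on `m`. -/
theorem strategyCoeff_succ_of_le {p : ℕ} (hp : 1 ≤ p) (γ : ℝ) {m : ℕ} (hm : p ≤ m + 1 + 1) :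
    strategyCoeff p γ (m + 1) =
      ∑ i ∈ range (p - 1), -fracCoeff (1 + γ) (i + 1) * strategyCoeff p γ (m - i) := by
  rw [strategyCoeff_succ hp]
  simp only [ite_mul, zero_mul]
  rw [← sum_filter]
  congr 1
  ext i
  simp only [mem_filter, mem_range]
  omega

/-- Below `p` the coefficients are explicit. Beyond, consecutive terms are combinations of shifted
windows with the same nonnegative weights, so monotonicity propagates. -/
theorem strategyCoeff_antitone {p : ℕ} (hp : 2 ≤ p) {γ : ℝ} (h0 : 0 < γ) (h1 : γ < 1) :
    Antitone (strategyCoeff p γ) := by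
  refine antitone_nat_of_succ_le fun m => ?_
  induction m using Nat.strong_induction_on with
  | _ m ih =>
    by_cases hm : m + 1 < p
    · rw [strategyCoeff_eq_fracCoeff γ hm, strategyCoeff_eq_fracCoeff γ (by omega : m < p)]
      exact fracCoeff_antitone (by linarith) (by linarith) (Nat.le_succ m)
    · obtain ⟨m, rfl⟩ : ∃ l, m = l + 1 := ⟨m - 1, by omega⟩
      rw [strategyCoeff_succ_of_le (by omega) γ (by omega),
        strategyCoeff_succ_of_le (by omega) γ (by omega)]
      refine sum_le_sum fun i hi => ?_
      rw [mem_range] at hi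
      refine mul_le_mul_of_nonneg_left ?_
        (by linarith [fracCoeff_one_add_succ_nonpos h0.le h1 i])
      have e : m + 1 - i = m - i + 1 := by omega
      rw [e]
      exact ih _ (by omega)

/-- From `C⁻¹ C = 1`, the convolution of `c` with the coefficients of `B` is constantly `1`, and
every coefficient of `B` is at least `fracCoeff γ (p - 1)`. -/
theorem sum_range_strategyCoeff_le {p : ℕ} (hp : 1 ≤ p) {γ : ℝ} (h0 : 0 ≤ γ) (h1 : γ < 1)
    (N : ℕ) : ∑ i ∈ range N, strategyCoeff p γ i ≤ (fracCoeff γ (p - 1))⁻¹ := by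
  have hg := fracCoeff_pos h1 (p - 1)
  rcases N with _ | N
  · simpa using hg.le
  have h : PowerSeries.coeff N ((truncSeries p γ)⁻¹ *
      ((PowerSeries.mk fun _ => 1) * truncSeries p γ)) = 1 := by
    rw [mul_left_comm, mul_comm _ (truncSeries p γ), truncSeries_mul_inv hp, mul_one,
      PowerSeries.coeff_mk]
  rw [PowerSeries.coeff_mul, Nat.sum_antidiagonal_eq_sum_range_succ_mk] at h
  rw [← one_div, le_div_iff₀ hg, ← h, sum_mul]
  refine sum_le_sum fun i _ => ?_
  rw [coeff_mk_one_mul_truncSeries hp]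
  exact mul_le_mul_of_nonneg_left (fracCoeff_antitone h0 h1 (min_le_right _ _))
    (strategyCoeff_nonneg hp h0 h1 i)

/-- In the tail, one factor of each square is bounded by the coefficient at `p - 1` and the other is
summed. -/
theorem sum_range_strategyCoeff_sq_le {p : ℕ} (hp : 2 ≤ p) {γ : ℝ} (h0 : 0 < γ) (h1 : γ < 1)
    (N : ℕ) : ∑ i ∈ range N, strategyCoeff p γ i ^ 2 ≤
      ∑ i ∈ range p, fracCoeff (1 - γ) i ^ 2 +
        fracCoeff (1 - γ) (p - 1) * (fracCoeff γ (p - 1))⁻¹ := by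
  have hc := strategyCoeff_nonneg (p := p) (by omega) h0.le h1
  have hg : 0 ≤ fracCoeff (1 - γ) (p - 1) := (fracCoeff_pos (by linarith) _).le
  rw [← sum_filter_add_sum_filter_not (range N) (fun i => i < p)]
  refine add_le_add ?_ ?_
  · refine (sum_le_sum_of_subset_of_nonneg (t := range p) ?_ fun _ _ _ => sq_nonneg _).trans_eq
      (sum_congr rfl fun i hi => ?_)
    · intro i hi
      exact mem_range.2 (mem_filter.1 hi).2
    · rw [strategyCoeff_eq_fracCoeff γ (mem_range.1 hi)]
  · refine le_trans ?_ (mul_le_mul_of_nonneg_left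
      (sum_range_strategyCoeff_le (p := p) (by omega) h0.le h1 N) hg)
    rw [mul_sum]
    refine (sum_le_sum fun i hi => ?_).trans
      (sum_le_sum_of_subset_of_nonneg (filter_subset _ _) fun i _ _ => mul_nonneg hg (hc i))
    rw [sq]
    refine mul_le_mul_of_nonneg_right ?_ (hc i)
    rw [← strategyCoeff_eq_fracCoeff γ (by omega : p - 1 < p)]
    have := (mem_filter.1 hi).2
    exact strategyCoeff_antitone hp h0 h1 (by omega)

/-! ### Frobenius norms and row and column sums. -/

open scoped Matrix.Norms.Frobenius

theorem frobenius_norm_sq {m n : ℕ} (A : Matrix (Fin m) (Fin n) ℝ) :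
    ‖A‖ ^ 2 = ∑ i, ∑ j, A i j ^ 2 := by
  rw [Matrix.frobenius_norm_def, ← Real.sqrt_eq_rpow, Real.sq_sqrt]
  · refine sum_congr rfl fun i _ => sum_congr rfl fun j _ => ?_
    rw [Real.rpow_two, Real.norm_eq_abs, sq_abs]
  · positivity

theorem sum_row_sub_le {n : ℕ} {f : ℕ → ℝ} (hf : ∀ m, 0 ≤ f m) (i : Fin n) :
    (∑ j : Fin n, if j ≤ i then f ((i : ℕ) - (j : ℕ)) else 0) ≤ ∑ m ∈ range n, f m := by
  rw [← sum_filter, ← sum_image (f := f) (g := fun j : Fin n => (i : ℕ) - (j : ℕ))]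
  · refine sum_le_sum_of_subset_of_nonneg ?_ fun _ _ _ => hf _
    intro m hm
    obtain ⟨j, -, rfl⟩ := mem_image.1 hm
    have := i.isLt
    rw [mem_range]
    omega
  · intro j hj l hl h
    simp only [coe_filter, mem_univ, true_and, Set.mem_ofPred_eq, Fin.le_def] at hj hl h
    ext
    omega

theorem sum_col_sub_le {n : ℕ} {f : ℕ → ℝ} (hf : ∀ m, 0 ≤ f m) (j : Fin n) :
    (∑ i : Fin n, if j ≤ i then f ((i : ℕ) - (j : ℕ)) else 0) ≤ ∑ m ∈ range n, f m := by
  rw [← sum_filter, ← sum_image (f := f) (g := fun i : Fin n => (i : ℕ) - (j : ℕ))]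
  · refine sum_le_sum_of_subset_of_nonneg ?_ fun _ _ _ => hf _
    intro m hm
    obtain ⟨i, -, rfl⟩ := mem_image.1 hm
    have := i.isLt
    rw [mem_range]
    omega
  · intro i hi l hl h
    simp only [coe_filter, mem_univ, true_and, Set.mem_ofPred_eq, Fin.le_def] at hi hl h
    ext
    omega

theorem norm_leftFactor_sq_le (n : ℕ) {p : ℕ} (hp : 1 ≤ p) (γ : ℝ) :
    ‖leftFactor n p γ‖ ^ 2 ≤
      n * (∑ m ∈ range p, fracCoeff γ m ^ 2 + n * fracCoeff γ (p - 1) ^ 2) := by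
  rw [frobenius_norm_sq, leftFactor_eq_toeplitz n hp]
  have hrow : ∀ i : Fin n, ∑ j, toeplitz n ((PowerSeries.mk fun _ => 1) * truncSeries p γ) i j ^ 2
      ≤ ∑ m ∈ range p, fracCoeff γ m ^ 2 + n * fracCoeff γ (p - 1) ^ 2 := by
    intro i
    simp only [toeplitz, Matrix.of_apply, coeff_mk_one_mul_truncSeries hp, ite_pow, ne_eq,
      OfNat.ofNat_ne_zero, not_false_eq_true, zero_pow]
    refine (sum_row_sub_le (f := fun m => fracCoeff γ (min m (p - 1)) ^ 2)
      (fun _ => sq_nonneg _) i).trans ?_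
    rw [← sum_filter_add_sum_filter_not (range n) (fun m => m < p)]
    refine add_le_add ?_ ?_
    · refine (sum_le_sum_of_subset_of_nonneg (t := range p) ?_
        fun _ _ _ => sq_nonneg _).trans_eq (sum_congr rfl fun m hm => ?_)
      · intro m hm
        exact mem_range.2 (mem_filter.1 hm).2
      · rw [mem_range] at hm
        rw [min_eq_left (by omega)]
    · refine (sum_le_card_nsmul _ _ (fracCoeff γ (p - 1) ^ 2) fun m hm => ?_).trans ?_
      · have := (mem_filter.1 hm).2
        rw [min_eq_right (by omega)]
      · rw [nsmul_eq_mul]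
        refine mul_le_mul_of_nonneg_right ?_ (sq_nonneg _)
        exact_mod_cast (card_filter_le _ _).trans_eq (card_range n)
  refine (sum_le_sum fun i _ => hrow i).trans_eq ?_
  simp [mul_add]

/-! ### Sensitivity -/

theorem sq_sum_eq_sum_sq_add {ι : Type*} [LinearOrder ι] (S : Finset ι) (x : ι → ℝ) :
    (∑ j ∈ S, x j) ^ 2 = ∑ j ∈ S, x j ^ 2 + 2 * ∑ j ∈ S, x j * ∑ l ∈ S with l < j, x l := by
  induction S using Finset.induction_on_max with
  | empty => simp
  | insert a s ha ih =>
    have hns : a ∉ s := fun h => lt_irrefl _ (ha a h)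
    rw [sum_insert hns, sum_insert hns, sum_insert hns]
    have e1 : (insert a s).filter (· < a) = s := by
      rw [filter_insert, if_neg (lt_irrefl a)]
      exact filter_true_of_mem ha
    have e2 : ∑ j ∈ s, x j * ∑ l ∈ insert a s with l < j, x l =
        ∑ j ∈ s, x j * ∑ l ∈ s with l < j, x l := by
      refine sum_congr rfl fun j hj => ?_
      rw [filter_insert, if_neg (ha j hj).not_gt]
    rw [e1, e2, add_sq, ih]
    ring

/-- Sampling an antitone sequence with gaps of at least `b`, the first `b` terms being left out,
costs at most the share `1 / b` of the whole sum. -/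
theorem mul_sum_sub_le {n k b : ℕ} {c : ℕ → ℝ} (hc : ∀ m, 0 ≤ c m) (ha : Antitone c)
    {S : Finset (Fin n)} (hS : IsParticipation k b S) {i j : Fin n} (hj : j ∈ S) (hji : j ≤ i) :
    b * ∑ l ∈ S with l < j, c ((i : ℕ) - (l : ℕ)) ≤ ∑ m ∈ range n, c m := by
  rw [mul_sum]
  have h1 : ∀ l ∈ S.filter (· < j), b * c ((i : ℕ) - (l : ℕ)) ≤
      ∑ r ∈ range b, c ((i : ℕ) - (l : ℕ) - r) := by
    intro l _
    have := card_nsmul_le_sum (range b) (fun r => c ((i : ℕ) - (l : ℕ) - r))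
      (c ((i : ℕ) - (l : ℕ))) fun r _ => ha (Nat.sub_le _ _)
    simpa using this
  refine (sum_le_sum h1).trans ?_
  rw [← sum_product', ← sum_image (f := c)
    (g := fun x : Fin n × ℕ => (i : ℕ) - (x.1 : ℕ) - x.2)]
  · refine sum_le_sum_of_subset_of_nonneg ?_ fun _ _ _ => hc _
    intro m hm
    obtain ⟨x, -, rfl⟩ := mem_image.1 hm
    have := i.isLt
    rw [mem_range]
    omega
  · rintro ⟨l, r⟩ hx ⟨l', r'⟩ hx' h
    simp only [coe_product, coe_filter, coe_range, Set.mem_prod, Set.mem_ofPred_eq,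
      Set.mem_Iio] at hx hx' h
    obtain ⟨⟨hl, hlj⟩, hr⟩ := hx
    obtain ⟨⟨hl', hlj'⟩, hr'⟩ := hx'
    -- Separation from `j ≤ i` gives `i - l ≥ b > r`, so no subtraction truncates and the blocks of
    -- length `b` are disjoint.
    have h2 := hS.2 l hl j hj hlj
    have h3 := hS.2 l' hl' j hj hlj'
    rw [Fin.le_def] at hji
    have hll : l = l' := by
      rcases lt_trichotomy l l' with h4 | h4 | h4
      · have := hS.2 l hl l' hl' h4
        omega
      · exact h4
      · have := hS.2 l' hl' l hl h4
        omega
    subst hll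
    refine Prod.ext rfl ?_
    dsimp only
    omega

/-- Expand the square by rows: the terms left of each `j` contribute at most `M / b`. Then sum by
columns, each having sum at most `M`. -/
theorem sum_sq_sum_participation_le {n k b : ℕ} (hb : 1 ≤ b) {c : ℕ → ℝ} (hc : ∀ m, 0 ≤ c m)
    (ha : Antitone c) {M : ℝ} (hM : ∑ m ∈ range n, c m ≤ M) {S : Finset (Fin n)}
    (hS : IsParticipation k b S) :
    ∑ i : Fin n, (∑ j ∈ S, if j ≤ i then c ((i : ℕ) - (j : ℕ)) else 0) ^ 2 ≤
      k * (∑ m ∈ range n, c m ^ 2 + 2 * M ^ 2 / b) := by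
  have hb0 : (0 : ℝ) < b := by exact_mod_cast hb
  have hM0 : 0 ≤ M := (sum_nonneg fun _ _ => hc _).trans hM
  set x : Fin n → Fin n → ℝ := fun i j => if j ≤ i then c ((i : ℕ) - (j : ℕ)) else 0 with hx
  have hx0 : ∀ i j, 0 ≤ x i j := by
    intro i j
    simp only [hx]
    split_ifs
    exacts [hc _, le_rfl]
  have h1 : ∀ i, (∑ j ∈ S, x i j) ^ 2 ≤ ∑ j ∈ S, (x i j ^ 2 + 2 * (M / b) * x i j) := by
    intro i
    rw [sq_sum_eq_sum_sq_add, sum_add_distrib, ← mul_sum, mul_assoc 2]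
    gcongr
    rw [mul_sum]
    refine sum_le_sum fun j hj => ?_
    by_cases hji : j ≤ i
    · rw [mul_comm]
      refine mul_le_mul_of_nonneg_right ?_ (hx0 i j)
      rw [le_div_iff₀ hb0, mul_comm]
      refine le_trans ?_ ((mul_sum_sub_le hc ha hS hj hji).trans hM)
      refine mul_le_mul_of_nonneg_left (sum_le_sum fun l hl => ?_) hb0.le
      simp only [hx]
      rw [if_pos ((mem_filter.1 hl).2.le.trans hji)]
    · simp [hx, hji]
  refine (sum_le_sum fun i _ => h1 i).trans ?_
  rw [sum_comm]
  have h2 : ∀ j ∈ S, ∑ i, (x i j ^ 2 + 2 * (M / b) * x i j) ≤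
      ∑ m ∈ range n, c m ^ 2 + 2 * M ^ 2 / b := by
    intro j _
    rw [sum_add_distrib, ← mul_sum]
    refine add_le_add ?_ ?_
    · refine le_trans (le_of_eq (sum_congr rfl fun i _ => ?_))
        (sum_col_sub_le (f := fun m => c m ^ 2) (fun _ => sq_nonneg _) j)
      simp [hx]
    · have h3 := (sum_col_sub_le hc j).trans hM
      refine (mul_le_mul_of_nonneg_left h3 (by positivity)).trans_eq ?_
      ring
  refine (sum_le_sum h2).trans ?_
  rw [sum_const, nsmul_eq_mul]
  refine mul_le_mul_of_nonneg_right (by exact_mod_cast hS.1) ?_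
  have : 0 ≤ ∑ m ∈ range n, c m ^ 2 := sum_nonneg fun _ _ => sq_nonneg _
  positivity

/-- For an entrywise nonnegative matrix the worst case is that all differences are aligned. -/
theorem frobenius_norm_sub_sq_le {n d k b : ℕ} {C : Matrix (Fin n) (Fin n) ℝ}
    (hC : ∀ i j, 0 ≤ C i j) {R : ℝ}
    (hR : ∀ S : Finset (Fin n), IsParticipation k b S → ∑ i, (∑ j ∈ S, C i j) ^ 2 ≤ R)
    {G G' : Matrix (Fin n) (Fin d) ℝ} (h : Neighbouring k b G G') :
    ‖C * G - C * G'‖ ^ 2 ≤ R := by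
  obtain ⟨S, hS, h0, h1⟩ := h
  refine le_trans ?_ (hR S hS)
  rw [frobenius_norm_sq]
  refine sum_le_sum fun i _ => ?_
  -- A row of the difference is a combination of row differences of norm at most `1`, so the
  -- triangle inequality applies.
  have e : ∑ l, (C * G - C * G') i l ^ 2 =
      ‖∑ j ∈ S, C i j • (WithLp.toLp 2 (G j) - WithLp.toLp 2 (G' j))‖ ^ 2 := by
    rw [EuclideanSpace.norm_sq_eq]
    refine sum_congr rfl fun l _ => ?_
    rw [Real.norm_eq_abs, sq_abs]
    congr 1
    rw [Matrix.sub_apply, Matrix.mul_apply, Matrix.mul_apply, ← sum_sub_distrib]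
    simp only [WithLp.ofLp_sum, Finset.sum_apply, WithLp.ofLp_smul, Pi.smul_apply,
      WithLp.ofLp_sub, Pi.sub_apply, smul_eq_mul]
    symm
    refine (sum_subset (subset_univ S) fun j _ hj => ?_).trans
      (sum_congr rfl fun j _ => mul_sub _ _ _)
    rw [h0 j hj, sub_self, mul_zero]
  rw [e]
  refine pow_le_pow_left₀ (norm_nonneg _) ?_ 2
  refine (norm_sum_le _ _).trans (sum_le_sum fun j hj => ?_)
  rw [norm_smul, Real.norm_eq_abs, abs_of_nonneg (hC i j)]
  exact mul_le_of_le_one_right (hC i j) (h1 j hj)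

theorem sens_strategy_le (n d k : ℕ) {p b : ℕ} (hp : 2 ≤ p) (hb : 1 ≤ b) {γ : ℝ} (h0 : 0 < γ)
    (h1 : γ < 1) :
    sens k b d (strategy n p γ) ≤ Real.sqrt (k * (∑ i ∈ range p, fracCoeff (1 - γ) i ^ 2 +
      fracCoeff (1 - γ) (p - 1) * (fracCoeff γ (p - 1))⁻¹ +
        2 * (fracCoeff γ (p - 1))⁻¹ ^ 2 / b)) := by
  refine csSup_le (sensSet_nonempty _ _ _ _) ?_
  rintro x ⟨G, G', hG, rfl⟩
  refine Real.le_sqrt_of_sq_le ?_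
  have hc := strategyCoeff_nonneg (p := p) (by omega) h0.le h1
  rw [strategy_eq_toeplitz n (by omega : 1 ≤ p)]
  refine frobenius_norm_sub_sq_le ?_ (fun S hS => ?_) hG
  · intro i j
    simp only [toeplitz, Matrix.of_apply]
    split_ifs
    exacts [hc _, le_rfl]
  · refine (sum_sq_sum_participation_le hb hc (strategyCoeff_antitone hp h0 h1)
      (sum_range_strategyCoeff_le (by omega) h0.le h1 n) hS).trans ?_
    gcongr
    exact sum_range_strategyCoeff_sq_le hp h0 h1 n

/-- The error bound in terms of the coefficients alone. -/
theorem rmse_le (n d k : ℕ) {p b : ℕ} (hn : 1 ≤ n) (hp : 2 ≤ p) (hb : 1 ≤ b) {γ : ℝ} (h0 : 0 < γ)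
    (h1 : γ < 1) :
    rmse k b d (leftFactor n p γ) (strategy n p γ) ≤
      Real.sqrt ((∑ m ∈ range p, fracCoeff γ m ^ 2 + n * fracCoeff γ (p - 1) ^ 2) *
        (k * (∑ i ∈ range p, fracCoeff (1 - γ) i ^ 2 +
          fracCoeff (1 - γ) (p - 1) * (fracCoeff γ (p - 1))⁻¹ +
            2 * (fracCoeff γ (p - 1))⁻¹ ^ 2 / b))) := by
  have hn0 : (0 : ℝ) < n := by exact_mod_cast hn
  have hA : 0 ≤ ∑ m ∈ range p, fracCoeff γ m ^ 2 + n * fracCoeff γ (p - 1) ^ 2 := by positivity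
  have hB := Real.le_sqrt_of_sq_le (norm_leftFactor_sq_le n (by omega : 1 ≤ p) γ)
  rw [Real.sqrt_mul hn0.le] at hB
  rw [rmse, div_le_iff₀ (Real.sqrt_pos.2 hn0), Real.sqrt_mul hA]
  calc _ ≤ ‖leftFactor n p γ‖ * _ :=
        mul_le_mul_of_nonneg_left (sens_strategy_le n d k hp hb h0 h1) (norm_nonneg _)
    _ ≤ _ := mul_le_mul_of_nonneg_right hB (Real.sqrt_nonneg _)
    _ = _ := by ring

/-! ### The regime of `γ` near `1/2`. -/

/-- The deviation of `x` from `1/2` costs `t^(1 - 2x) ≤ exp (1/2) ≤ 2`. -/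
theorem sq_rpow_neg_le_two_div {L x t : ℝ} (hL : 0 < L) (hx : |x - 1 / 2| ≤ 1 / (4 * L))
    (ht : 1 ≤ t) (htL : Real.log t ≤ L) : (t ^ (-x)) ^ 2 ≤ 2 / t := by
  have ht0 : 0 < t := by linarith
  have e : (t ^ (-x)) ^ 2 = Real.exp (Real.log t * (1 - 2 * x)) / t := by
    rw [← Real.rpow_natCast, ← Real.rpow_mul ht0.le, ← Real.rpow_def_of_pos ht0,
      ← Real.rpow_sub_one ht0.ne']
    congr 1
    push_cast
    ring
  rw [e]
  refine div_le_div_of_nonneg_right ?_ ht0.le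
  have h1 : Real.log t * (1 - 2 * x) ≤ 1 / 2 := by
    have hlog : 0 ≤ Real.log t := Real.log_nonneg ht
    have h2 : 1 - 2 * x ≤ 1 / (2 * L) := by
      have h3 := (abs_le.1 hx).1
      have h4 : 1 / (2 * L) = 2 * (1 / (4 * L)) := by field_simp; norm_num
      linarith
    have h5 : 0 ≤ 1 / (2 * L) := by positivity
    calc _ ≤ Real.log t * (1 / (2 * L)) := mul_le_mul_of_nonneg_left h2 hlog
      _ ≤ L * (1 / (2 * L)) := mul_le_mul_of_nonneg_right htL h5
      _ = 1 / 2 := by field_simp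
  refine (Real.exp_le_exp.2 h1).trans ?_
  have h6 : Real.exp (1 / 2) ^ 2 = Real.exp 1 := by
    rw [← Real.exp_nat_mul]
    norm_num
  have h7 := Real.exp_one_lt_d9
  nlinarith [Real.exp_pos (1 / 2)]

theorem sum_range_fracCoeff_sq_le_log {p : ℕ} (hp : 2 ≤ p) {x : ℝ} (h0 : 0 < x) (h1 : x < 1)
    (hx : |x - 1 / 2| ≤ 1 / (4 * Real.log p)) :
    ∑ m ∈ range p, fracCoeff x m ^ 2 ≤ 5 * Real.log p := by
  have hp2 : (2 : ℝ) ≤ p := by exact_mod_cast hp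
  have hL2 : 0.6931471803 < Real.log p :=
    Real.log_two_gt_d9.trans_le (Real.log_le_log (by norm_num) hp2)
  have h2 : ∀ m ∈ range p, fracCoeff x m ^ 2 ≤ 2 * ((m : ℝ) + 1)⁻¹ := by
    intro m hm
    rw [← div_eq_mul_inv]
    refine (pow_le_pow_left₀ (fracCoeff_pos h1 m).le (fracCoeff_le_rpow h0.le h1 m) 2).trans ?_
    have hm0 : (0 : ℝ) ≤ m := by positivity
    refine sq_rpow_neg_le_two_div (by linarith) hx (by linarith)
      (Real.log_le_log (by positivity) ?_)
    exact_mod_cast mem_range.1 hm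
  refine (sum_le_sum h2).trans ?_
  rw [← mul_sum]
  -- `2 (1 + log p) ≤ 5 log p` because `log p ≥ log 2 > 2/3`.
  have h3 := harmonic_le_one_add_log p
  rw [harmonic] at h3
  push_cast at h3
  linarith

theorem mul_rpow_neg_le_fracCoeff_sub_one {p : ℕ} (hp : 2 ≤ p) {γ : ℝ} (h0 : 0 ≤ γ) (h1 : γ < 1) :
    (1 - γ) * (p : ℝ) ^ (-γ) ≤ fracCoeff γ (p - 1) := by
  refine le_trans ?_ (mul_rpow_le_fracCoeff h0 h1 (by omega : 1 ≤ p - 1))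
  refine mul_le_mul_of_nonneg_left (Real.rpow_le_rpow_of_nonpos ?_ ?_ (by linarith)) (by linarith)
  · exact_mod_cast (by omega : 0 < p - 1)
  · exact_mod_cast Nat.sub_le p 1

theorem fracCoeff_sub_one_le_rpow {p : ℕ} (hp : 1 ≤ p) {γ : ℝ} (h0 : 0 ≤ γ) (h1 : γ < 1) :
    fracCoeff γ (p - 1) ≤ (p : ℝ) ^ (-γ) := by
  have h := fracCoeff_le_rpow h0 h1 (p - 1)
  rwa [Nat.cast_sub hp, Nat.cast_one, sub_add_cancel] at h

theorem mem_Icc_of_abs_sub_half_le {p : ℕ} (hp : 2 ≤ p) {γ : ℝ}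
    (hγ : |γ - 1 / 2| ≤ 1 / (4 * Real.log p)) : γ ∈ Set.Icc (1 / 8 : ℝ) (7 / 8) := by
  have hp2 : (2 : ℝ) ≤ p := by exact_mod_cast hp
  have hL2 : 0.6931471803 < Real.log p :=
    Real.log_two_gt_d9.trans_le (Real.log_le_log (by norm_num) hp2)
  have h : 1 / (4 * Real.log p) ≤ 3 / 8 := by
    rw [div_le_div_iff₀ (by linarith) (by norm_num)]
    linarith
  have := abs_le.1 (hγ.trans h)
  constructor <;> linarith

theorem rmse_le_of_abs_sub_half_le {n p k b : ℕ} (d : ℕ) (hp : 2 ≤ p) (hpn : p ≤ n) (hb : 1 ≤ b)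
    {γ : ℝ} (hγ : |γ - 1 / 2| ≤ 1 / (4 * Real.log p)) :
    rmse k b d (leftFactor n p γ) (strategy n p γ) ≤
      36 * (Real.sqrt k * Real.log p + Real.sqrt ((n : ℝ) * k / b)
        + Real.sqrt ((n : ℝ) * k * Real.log p / p) + Real.sqrt ((k : ℝ) * p * Real.log p / b)) := by
  obtain ⟨hg0, hg1⟩ := mem_Icc_of_abs_sub_half_le hp hγ
  have h0 : 0 < γ := by linarith
  have h1 : γ < 1 := by linarith
  have hγ' : |(1 - γ) - 1 / 2| ≤ 1 / (4 * Real.log p) := by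
    rw [← abs_neg]
    convert hγ using 2
    ring
  have hp2 : (2 : ℝ) ≤ p := by exact_mod_cast hp
  have hp0 : (0 : ℝ) < p := by linarith
  have hb0 : (0 : ℝ) < b := by exact_mod_cast hb
  have hn0 : (0 : ℝ) ≤ n := by positivity
  have hk0 : (0 : ℝ) ≤ k := by positivity
  refine (rmse_le n d k (by omega) hp hb h0 h1).trans ?_
  set L := Real.log p with hLdef
  have hL2 : 0.6931471803 < L :=
    Real.log_two_gt_d9.trans_le (Real.log_le_log (by norm_num) hp2)
  have hL0 : 0 < L := by linarith
  have hs1 := sum_range_fracCoeff_sq_le_log hp h0 h1 hγ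
  have hs2 := sum_range_fracCoeff_sq_le_log hp (by linarith) (by linarith) hγ'
  have hP : (0 : ℝ) < (p : ℝ) ^ γ := Real.rpow_pos_of_pos hp0 _
  have hPinv : (p : ℝ) ^ (-γ) = ((p : ℝ) ^ γ)⁻¹ := Real.rpow_neg hp0.le _
  have hPone : (p : ℝ) ^ (-(1 - γ)) = (p : ℝ) ^ γ / p := by
    rw [← Real.rpow_sub_one hp0.ne']
    congr 1
    ring
  have hPsq : ((p : ℝ) ^ γ) ^ 2 ≤ 2 * p := by
    have h := sq_rpow_neg_le_two_div hL0 hγ' (by linarith : (1 : ℝ) ≤ p) le_rfl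
    rw [hPone, div_pow, div_le_div_iff₀ (by positivity) hp0] at h
    nlinarith
  have hgl := mul_rpow_neg_le_fracCoeff_sub_one hp h0.le h1
  have hgp := fracCoeff_pos h1 (p - 1)
  have hM : (fracCoeff γ (p - 1))⁻¹ ≤ 8 * (p : ℝ) ^ γ := by
    rw [← one_div, div_le_iff₀ hgp]
    rw [hPinv] at hgl
    have h2 : 1 / 8 * ((p : ℝ) ^ γ)⁻¹ ≤ fracCoeff γ (p - 1) :=
      (mul_le_mul_of_nonneg_right (by linarith) (by positivity)).trans hgl
    calc (1 : ℝ) = 8 * (p : ℝ) ^ γ * (1 / 8 * ((p : ℝ) ^ γ)⁻¹) := by field_simp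
      _ ≤ _ := mul_le_mul_of_nonneg_left h2 (by positivity)
  have hM0 : 0 < (fracCoeff γ (p - 1))⁻¹ := by positivity
  have hA : (n : ℝ) * fracCoeff γ (p - 1) ^ 2 ≤ n * (2 / p) := by
    refine mul_le_mul_of_nonneg_left ?_ hn0
    exact (pow_le_pow_left₀ hgp.le (fracCoeff_sub_one_le_rpow (by omega) h0.le h1) 2).trans
      (sq_rpow_neg_le_two_div hL0 hγ (by linarith) le_rfl)
  have hB : fracCoeff (1 - γ) (p - 1) * (fracCoeff γ (p - 1))⁻¹ ≤ 16 := by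
    have h2 := fracCoeff_sub_one_le_rpow (p := p) (by omega) (by linarith : 0 ≤ 1 - γ)
      (by linarith)
    rw [hPone] at h2
    refine (mul_le_mul h2 hM hM0.le (by positivity)).trans ?_
    rw [div_mul_eq_mul_div, div_le_iff₀ hp0]
    nlinarith
  have hC : 2 * (fracCoeff γ (p - 1))⁻¹ ^ 2 / b ≤ 256 * p / b := by
    refine div_le_div_of_nonneg_right ?_ hb0.le
    nlinarith [pow_le_pow_left₀ hM0.le hM 2]
  have hprod : (∑ m ∈ range p, fracCoeff γ m ^ 2 + n * fracCoeff γ (p - 1) ^ 2) *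
        (k * (∑ i ∈ range p, fracCoeff (1 - γ) i ^ 2 +
          fracCoeff (1 - γ) (p - 1) * (fracCoeff γ (p - 1))⁻¹ +
            2 * (fracCoeff γ (p - 1))⁻¹ ^ 2 / b)) ≤
      -- Equal constants in each factor make the product expand into exactly the four squared target
      -- terms; `5 * 256 = 1280 ≤ 36 ^ 2`.
      (5 * L + 5 * (n / p)) * (k * (256 * L + 256 * (p / b))) := by
    refine mul_le_mul ?_ (mul_le_mul_of_nonneg_left ?_ hk0) ?_ (by positivity)
    · have : 0 ≤ (n : ℝ) / p := by positivity
      rw [mul_div_left_comm] at hA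
      linarith
    · rw [mul_div_assoc 256] at hC
      linarith
    · have := (fracCoeff_pos (by linarith : 1 - γ < 1) (p - 1)).le
      positivity
  refine Real.sqrt_le_iff.2 ⟨by positivity, hprod.trans ?_⟩
  have q1 : (Real.sqrt k * L) ^ 2 = k * L ^ 2 := by rw [mul_pow, Real.sq_sqrt hk0]
  have q2 := Real.sq_sqrt (show 0 ≤ (n : ℝ) * k / b by positivity)
  have q3 := Real.sq_sqrt (show 0 ≤ (n : ℝ) * k * L / p by positivity)
  have q4 := Real.sq_sqrt (show 0 ≤ (k : ℝ) * p * L / b by positivity)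
  have e : (5 * L + 5 * ((n : ℝ) / p)) * (k * (256 * L + 256 * (p / b))) =
      1280 * (k * L ^ 2 + n * k / b + n * k * L / p + k * p * L / b) := by
    field_simp
    ring
  rw [e]
  have r1 : 0 ≤ Real.sqrt k * L := by positivity
  have r2 := Real.sqrt_nonneg ((n : ℝ) * k / b)
  have r3 := Real.sqrt_nonneg ((n : ℝ) * k * L / p)
  have r4 := Real.sqrt_nonneg ((k : ℝ) * p * L / b)
  generalize Real.sqrt k * L = a1 at *
  generalize Real.sqrt ((n : ℝ) * k / b) = a2 at *
  generalize Real.sqrt ((n : ℝ) * k * L / p) = a3 at *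
  generalize Real.sqrt ((k : ℝ) * p * L / b) = a4 at *
  have s1 : a1 ^ 2 + a2 ^ 2 + a3 ^ 2 + a4 ^ 2 ≤ (a1 + a2 + a3 + a4) ^ 2 := by
    have := mul_nonneg r1 r2
    have := mul_nonneg r1 r3
    have := mul_nonneg r1 r4
    have := mul_nonneg r2 r3
    have := mul_nonneg r2 r4
    have := mul_nonneg r3 r4
    linarith [(by ring : (a1 + a2 + a3 + a4) ^ 2 = a1 ^ 2 + a2 ^ 2 + a3 ^ 2 + a4 ^ 2 +
      2 * (a1 * a2 + a1 * a3 + a1 * a4 + a2 * a3 + a2 * a4 + a3 * a4))]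
  rw [mul_pow]
  have s2 : 0 ≤ (a1 + a2 + a3 + a4) ^ 2 := sq_nonneg _
  linarith

/-! ### The regime `γ = 1 - p / √n`. -/

theorem sq_sqrt_mul_rpow_one_div_four (n k : ℕ) :
    (Real.sqrt k * (n : ℝ) ^ (1 / 4 : ℝ)) ^ 2 = k * Real.sqrt n := by
  have hn0 : (0 : ℝ) ≤ n := by positivity
  rw [mul_pow, Real.sq_sqrt (by positivity), ← Real.rpow_natCast, ← Real.rpow_mul hn0,
    Real.sqrt_eq_rpow]
  norm_num

theorem rmse_le_of_eq_one_sub {n p k b : ℕ} (d : ℕ) (hp : 2 ≤ p) (hpn : p ≤ n) (hb : 1 ≤ b)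
    (hpq : (p : ℝ) ≤ Real.sqrt n / 4) :
    rmse k b d (leftFactor n p (1 - p / Real.sqrt n)) (strategy n p (1 - p / Real.sqrt n)) ≤
      4 * (Real.sqrt k * (n : ℝ) ^ (1 / 4 : ℝ) + Real.sqrt ((n : ℝ) * k / b)) := by
  have hp2 : (2 : ℝ) ≤ p := by exact_mod_cast hp
  have hp0 : (0 : ℝ) < p := by linarith
  have hb0 : (0 : ℝ) < b := by exact_mod_cast hb
  have hk0 : (0 : ℝ) ≤ k := by positivity
  have hq4 := sq_sqrt_mul_rpow_one_div_four n k
  have hsq : Real.sqrt n ^ 2 = n := Real.sq_sqrt (by positivity)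
  set s := Real.sqrt n with hs
  have hs0 : 0 < s := by linarith
  set δ := (p : ℝ) / s with hδ
  have hδ0 : 0 < δ := by positivity
  have hδ1 : δ ≤ 1 / 4 := by
    rw [hδ, div_le_iff₀ hs0]
    linarith
  set γ := 1 - δ with hγ
  have h0 : 0 < γ := by linarith
  have h1 : γ < 1 := by linarith
  have hγδ : 1 - γ = δ := by ring
  refine (rmse_le n d k (by omega) hp hb h0 h1).trans ?_
  rw [hγδ]
  set P := (p : ℝ) ^ δ with hPdef
  have hP1 : 1 ≤ P := Real.one_le_rpow (by linarith) hδ0.le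
  have hP0 : 0 < P := by linarith
  have hPδ : (p : ℝ) ^ (-δ) = P⁻¹ := Real.rpow_neg hp0.le _
  have hPγ : (p : ℝ) ^ (-γ) = P / p := by
    rw [hPdef, ← Real.rpow_sub_one hp0.ne']
    congr 1
    ring
  have hgp := fracCoeff_pos h1 (p - 1)
  have hM : (fracCoeff γ (p - 1))⁻¹ ≤ s / P := by
    have hgl := mul_rpow_neg_le_fracCoeff_sub_one hp h0.le h1
    rw [hγδ, hPγ] at hgl
    have e : s / P = (δ * (P / p))⁻¹ := by
      rw [hδ]
      field_simp
    rw [e]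
    exact inv_anti₀ (by positivity) hgl
  have hM0 : 0 < (fracCoeff γ (p - 1))⁻¹ := by positivity
  have hA : (n : ℝ) * fracCoeff γ (p - 1) ^ 2 ≤ 4 * P ^ 2 := by
    have h := fracCoeff_le_mul_rpow h0.le h1 (by omega : 1 ≤ p - 1)
    rw [Nat.cast_sub (by omega), Nat.cast_one, sub_add_cancel, hγδ, hPγ] at h
    refine (mul_le_mul_of_nonneg_left (pow_le_pow_left₀ hgp.le h 2) (by positivity)).trans_eq ?_
    rw [← hsq, hδ]
    field_simp
    norm_num
  have hA' : ∑ m ∈ range p, fracCoeff γ m ^ 2 ≤ 3 * P ^ 2 := by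
    -- The term `m = 0` equals `1` and lacks the factor `δ`; for the others the square is at most
    -- the first power.
    have h2 : ∀ m ∈ range p, fracCoeff γ m ^ 2 ≤
        (if m = 0 then 1 else 0) + 2 * δ * ((m : ℝ) + 1) ^ (-γ) := by
      intro m _
      have hle := fracCoeff_le_one h0.le h1 m
      have hpos := fracCoeff_pos h1 m
      split_ifs with hm
      · have : 0 ≤ 2 * δ * ((m : ℝ) + 1) ^ (-γ) := by positivity
        linarith [pow_le_one₀ (n := 2) hpos.le hle]
      · have := fracCoeff_le_mul_rpow h0.le h1 (by omega : 1 ≤ m)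
        rw [hγδ] at this
        linarith [pow_le_of_le_one hpos.le hle two_ne_zero]
    refine (sum_le_sum h2).trans ?_
    have h3 := sum_range_rpow_neg_le h0.le h1 (by omega : 1 ≤ p)
    rw [hγδ, le_div_iff₀ hδ0] at h3
    rw [sum_add_distrib, ← mul_sum, sum_ite_eq' (range p) 0, if_pos (mem_range.2 (by omega))]
    have h4 : P ≤ P ^ 2 := le_self_pow₀ hP1 two_ne_zero
    have h5 : 1 ≤ P ^ 2 := one_le_pow₀ hP1
    linarith
  have hB : ∑ i ∈ range p, fracCoeff δ i ^ 2 ≤ s / P ^ 2 := by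
    have h2 : ∀ m ∈ range p, fracCoeff δ m ^ 2 ≤ ((m : ℝ) + 1) ^ (-(2 * δ)) := by
      intro m _
      refine (pow_le_pow_left₀ (fracCoeff_pos (by linarith) m).le
        (fracCoeff_le_rpow hδ0.le (by linarith) m) 2).trans_eq ?_
      rw [← Real.rpow_natCast, ← Real.rpow_mul (by positivity)]
      congr 1
      push_cast
      ring
    refine (sum_le_sum h2).trans ((sum_range_rpow_neg_le (by linarith) (by linarith)
      (by omega : 1 ≤ p)).trans ?_)
    have e : (p : ℝ) ^ (1 - 2 * δ) = p / P ^ 2 := by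
      rw [Real.rpow_sub hp0, Real.rpow_one, hPdef, ← Real.rpow_natCast, ← Real.rpow_mul hp0.le]
      congr 2
      push_cast
      ring
    rw [e, div_right_comm]
    refine div_le_div_of_nonneg_right ?_ (by positivity)
    rw [div_le_iff₀ (by linarith)]
    have := mul_le_mul_of_nonneg_left (by linarith : 1 / 2 ≤ 1 - 2 * δ) hs0.le
    linarith
  have hB' : fracCoeff δ (p - 1) * (fracCoeff γ (p - 1))⁻¹ ≤ s / P ^ 2 := by
    have h2 := fracCoeff_sub_one_le_rpow (p := p) (by omega) hδ0.le (by linarith)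
    rw [hPδ] at h2
    refine (mul_le_mul h2 hM hM0.le (by positivity)).trans_eq ?_
    field_simp
  have hC : 2 * (fracCoeff γ (p - 1))⁻¹ ^ 2 / b ≤ 2 * (n / b) / P ^ 2 := by
    have h2 := pow_le_pow_left₀ hM0.le hM 2
    rw [div_pow, hsq] at h2
    have e : 2 * ((n : ℝ) / b) / P ^ 2 = 2 * (n / P ^ 2) / b := by
      field_simp
    rw [e]
    gcongr
  have hprod : (∑ m ∈ range p, fracCoeff γ m ^ 2 + n * fracCoeff γ (p - 1) ^ 2) *
        (k * (∑ i ∈ range p, fracCoeff δ i ^ 2 +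
          fracCoeff δ (p - 1) * (fracCoeff γ (p - 1))⁻¹ +
            2 * (fracCoeff γ (p - 1))⁻¹ ^ 2 / b)) ≤
      -- `7 = 3 + 4` from `hA'` and `hA`; once `P` cancels, `14 ≤ 4 ^ 2` suffices.
      (7 * P ^ 2) * (k * ((2 * s + 2 * (n / b)) / P ^ 2)) := by
    refine mul_le_mul (by linarith) (mul_le_mul_of_nonneg_left ?_ hk0) ?_ (by positivity)
    · have e : (2 * s + 2 * ((n : ℝ) / b)) / P ^ 2 =
          s / P ^ 2 + s / P ^ 2 + 2 * (n / b) / P ^ 2 := by ring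
      rw [e]
      linarith
    · have := (fracCoeff_pos (by linarith : δ < 1) (p - 1)).le
      positivity
  refine Real.sqrt_le_iff.2 ⟨by positivity, hprod.trans ?_⟩
  have q2 := Real.sq_sqrt (show 0 ≤ (n : ℝ) * k / b by positivity)
  have e : (7 * P ^ 2) * (k * ((2 * s + 2 * ((n : ℝ) / b)) / P ^ 2)) =
      14 * (k * s + n * k / b) := by
    field_simp
    ring
  rw [e]
  have r1 : 0 ≤ Real.sqrt k * (n : ℝ) ^ (1 / 4 : ℝ) := by positivity
  have r2 := Real.sqrt_nonneg ((n : ℝ) * k / b)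
  generalize Real.sqrt k * (n : ℝ) ^ (1 / 4 : ℝ) = a1 at *
  generalize Real.sqrt ((n : ℝ) * k / b) = a2 at *
  rw [mul_pow, add_sq]
  linarith [mul_nonneg r1 r2, sq_nonneg a1, sq_nonneg a2]

/-- Squared, this is `p < √n log p`; the third term of the first bound alone thus exceeds the new
term. -/
theorem sqrt_mul_rpow_lt_sqrt_div {n p k : ℕ} (hp : 2 ≤ p) (hk : 1 ≤ k)
    (hpq : (p : ℝ) ≤ Real.sqrt n / 4) :
    Real.sqrt k * (n : ℝ) ^ (1 / 4 : ℝ) < Real.sqrt ((n : ℝ) * k * Real.log p / p) := by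
  have hp2 : (2 : ℝ) ≤ p := by exact_mod_cast hp
  have hp0 : (0 : ℝ) < p := by linarith
  have hk0 : (0 : ℝ) < k := by exact_mod_cast hk
  have hL2 : 0.6931471803 < Real.log p :=
    Real.log_two_gt_d9.trans_le (Real.log_le_log (by norm_num) hp2)
  refine Real.lt_sqrt_of_sq_lt ?_
  rw [sq_sqrt_mul_rpow_one_div_four, lt_div_iff₀ hp0]
  have hsq : Real.sqrt n ^ 2 = n := Real.sq_sqrt (by positivity)
  set s := Real.sqrt n
  have hs0 : 0 < s := by linarith
  rw [← hsq]
  have h2 : (p : ℝ) < s * Real.log p := by nlinarith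
  have h3 := mul_lt_mul_of_pos_left h2 (mul_pos hk0 hs0)
  linarith [(by ring : (k : ℝ) * s * (s * Real.log p) = s ^ 2 * k * Real.log p)]

end BIFR

end

theorem theorem3p2 :
    ∃ K : ℝ, 0 < K ∧ ∀ n p k b d : ℕ,
      2 ≤ p → p ≤ n → 1 ≤ b → 1 ≤ k → (k : ℝ) ≤ (n : ℝ) / (b : ℝ) → 1 ≤ d →
      (∀ γ : ℝ, |γ - 1 / 2| ≤ 1 / (4 * Real.log p) →
        0 < γ ∧ γ < 1 ∧
        BIFR.rmse k b d (BIFR.leftFactor n p γ) (BIFR.strategy n p γ) ≤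
          K * (Real.sqrt k * Real.log p
            + Real.sqrt ((n : ℝ) * k / b)
            + Real.sqrt ((n : ℝ) * k * Real.log p / p)
            + Real.sqrt ((k : ℝ) * p * Real.log p / b))) ∧
      ((p : ℝ) ≤ Real.sqrt n / 4 → ∀ γ : ℝ, γ = 1 - (p : ℝ) / Real.sqrt n →
        0 < γ ∧ γ < 1 ∧
        BIFR.rmse k b d (BIFR.leftFactor n p γ) (BIFR.strategy n p γ) ≤
          K * (Real.sqrt k * (n : ℝ) ^ (1 / 4 : ℝ) + Real.sqrt ((n : ℝ) * k / b)) ∧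
        Real.sqrt k * (n : ℝ) ^ (1 / 4 : ℝ) + Real.sqrt ((n : ℝ) * k / b) <
          Real.sqrt k * Real.log p
            + Real.sqrt ((n : ℝ) * k / b)
            + Real.sqrt ((n : ℝ) * k * Real.log p / p)
            + Real.sqrt ((k : ℝ) * p * Real.log p / b)) := by
  refine ⟨36, by norm_num, fun n p k b d hp hpn hb hk _ _ => ⟨fun γ hγ => ?_, ?_⟩⟩
  · obtain ⟨h0, h1⟩ := BIFR.mem_Icc_of_abs_sub_half_le hp hγ
    exact ⟨by linarith, by linarith, BIFR.rmse_le_of_abs_sub_half_le d hp hpn hb hγ⟩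
  · rintro hpq γ rfl
    have hp2 : (2 : ℝ) ≤ p := by exact_mod_cast hp
    have hs0 : 0 < Real.sqrt n := by linarith
    have hk0 : (0 : ℝ) < k := by exact_mod_cast hk
    have hlog : 0 < Real.log p := Real.log_pos (by linarith)
    have hδ : (p : ℝ) / Real.sqrt n ≤ 1 / 4 := by
      rw [div_le_iff₀ hs0]
      linarith
    have hδ0 : 0 < (p : ℝ) / Real.sqrt n := by positivity
    refine ⟨by linarith, by linarith, ?_, ?_⟩
    · refine (BIFR.rmse_le_of_eq_one_sub d hp hpn hb hpq).trans ?_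
      exact mul_le_mul_of_nonneg_right (by norm_num) (by positivity)
    · have h1 := BIFR.sqrt_mul_rpow_lt_sqrt_div hp hk hpq
      have h2 : 0 < Real.sqrt k * Real.log p := by positivity
      have h3 := Real.sqrt_nonneg ((k : ℝ) * p * Real.log p / b)
      linarith
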